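/- Let $\mathbf{Top}_0$ be the category of $T_0$ topological spaces and continuous maps, and let $\mathbb F=(F,m,e)$ be the open filter monad on it: $FX$ is the set of all (not necessarily proper) filters on the lattice of open subsets of $X$, with the topology generated by the sets $A^\#=\{\varphi\in FX\mid A\in\varphi\}$ for $A\subseteq X$ open; $Ff(\varphi)=\{B\mid f^{-1}(B)\in\varphi\}$; $e_X(x)$ is the filter of open neighbourhoods of $x$; and $m_X(\Phi)=\{A\mid A^\#\in\Phi\}$. Let $\mathbf{ContLat}$ be the category of continuous lattices (complete lattices in which every element is the directed supremum of the elements way below it) and maps preserving directed suprema and arbitrary infima. The Kleisli category $(\mathbf{Top}_0)_{\mathbb F}$ is regarded as a category over $\mathbf{ContLat}$ through the canonical functor $J$ that sends $X$ to $FX$, ordered by inclusion, and a Kleisli morphism $r:X\to FY$ to its extension $m_Y\cdot Fr:FX\to FY$. For a complete lattice $A$ let $K(A)$ be the set of its compact elements with the induced order. **Theorem.** The idempotent split completion of the Kleisli category $(\mathbf{Top}_0)_{\mathbb F}$ is the full subcategory $\mathbf A$ of $\mathbf{ContLat}$ consisting of all algebraic lattices $A$ such that the poset $K(A)$ is the dual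 of a frame. Precisely: 1. There is an equivalence of categories $E:\mathrm{kar}\big((\mathbf{Top}_0)_{\mathbb F}\big)\to\mathbf A$, where $\mathrm{kar}$ denotes the idempotent split completion (Karoubi envelope), such that the composite $(\mathbf{Top}_0)_{\mathbb F}\to\mathrm{kar}\big((\mathbf{Top}_0)_{\mathbb F}\big)\xrightarrow{E}\mathbf A\hookrightarrow\mathbf{ContLat}$ is naturally isomorphic to $J$. 2. A continuous lattice $A$ belongs to $\mathbf A$ if and only if it is a retract, in $\mathbf{ContLat}$, of $FX$ for some $T_0$-space $X$. 3. For every algebraic lattice $A$, the poset $K(A)$ is the dual of a frame if and only if $K(A)$ is closed in $A$ under arbitrary infima (including the empty one) and finite joins distribute over arbitrary meets in $K(A)$, that is, $c\vee\bigwedge S=\bigwedge_{s\in S}(c\vee s)$ for all $c\in K(A)$ and $S\subseteq K(A)$. -/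

import Mathlib

open CategoryTheory TopologicalSpace

universe u

/-! ## Filters of open sets -/

/-- Filters (not necessarily proper) on the lattice of open subsets of `X`. -/
def OpenFilter (X : Type u) [TopologicalSpace X] : Type u := Order.PFilter (Opens X)

namespace OpenFilter

variable {X Y : Type u} [TopologicalSpace X] [TopologicalSpace Y]

instance : SetLike (OpenFilter X) (Opens X) :=
  inferInstanceAs (SetLike (Order.PFilter (Opens X)) (Opens X))

theorem top_mem (φ : OpenFilter X) : (⊤ : Opens X) ∈ φ :=
  Order.PFilter.top_mem (F := φ)

theorem inf_mem (φ : OpenFilter X) {U V : Opens X} (hU : U ∈ φ) (hV : V ∈ φ) : U ⊓ V ∈ φ :=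
  Order.PFilter.inf_mem (F := φ) hU hV

theorem mem_of_le (φ : OpenFilter X) {U V : Opens X} (h : U ≤ V) (hU : U ∈ φ) : V ∈ φ :=
  Order.PFilter.mem_of_le (F := φ) h hU

@[ext] theorem ext {φ ψ : OpenFilter X} (h : ∀ U, U ∈ φ ↔ U ∈ ψ) : φ = ψ := SetLike.ext h

/-- The filter of all opens with the property `p`. -/
def ofProp (p : Opens X → Prop) (h1 : p ⊤) (h2 : ∀ U V, p U → p V → p (U ⊓ V))
    (h3 : ∀ U V, U ≤ V → p U → p V) : OpenFilter X :=
  Order.IsPFilter.toPFilter (F := {U | p U}) (Order.IsPFilter.of_def ⟨⊤, h1⟩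
    (fun U hU V hV => ⟨U ⊓ V, h2 U V hU hV, inf_le_left, inf_le_right⟩)
    (fun h hU => h3 _ _ h hU))

@[simp] theorem mem_ofProp {p : Opens X → Prop} {h1 h2 h3} {U : Opens X} :
    U ∈ ofProp p h1 h2 h3 ↔ p U := Iff.rfl

/-- Filters of opens are ordered by inclusion. -/
instance : PartialOrder (OpenFilter X) := .ofSetLike (OpenFilter X) (Opens X)

theorem le_def {φ ψ : OpenFilter X} : φ ≤ ψ ↔ ∀ U, U ∈ φ → U ∈ ψ := Iff.rfl

instance : InfSet (OpenFilter X) where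
  sInf S := ofProp (fun U => ∀ φ ∈ S, U ∈ φ) (fun φ _ => φ.top_mem)
    (fun _ _ hU hV φ hφ => φ.inf_mem (hU φ hφ) (hV φ hφ))
    (fun _ _ h hU φ hφ => φ.mem_of_le h (hU φ hφ))

theorem mem_sInf {S : Set (OpenFilter X)} {U : Opens X} : U ∈ sInf S ↔ ∀ φ ∈ S, U ∈ φ := Iff.rfl

instance : CompleteLattice (OpenFilter X) :=
  completeLatticeOfInf (OpenFilter X) fun _ =>
    ⟨fun φ hφ _ hU => hU φ hφ, fun _ hψ U hU φ hφ => hψ hφ hU⟩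

/-- The filter of all opens containing `U`. -/
def principal (U : Opens X) : OpenFilter X :=
  ofProp (fun V => U ≤ V) le_top (fun _ _ h h' => le_inf h h') (fun _ _ h h' => le_trans h' h)

theorem principal_le {U : Opens X} {φ : OpenFilter X} : principal U ≤ φ ↔ U ∈ φ :=
  ⟨fun h => le_def.1 h U (le_refl U), fun h => le_def.2 fun _ hV => φ.mem_of_le hV h⟩

/-- A directed supremum of filters is their union. -/
theorem mem_of_isLUB {D : Set (OpenFilter X)} (hne : D.Nonempty) (hD : DirectedOn (· ≤ ·) D)
    {φ : OpenFilter X} (hφ : IsLUB D φ) {U : Opens X} : U ∈ φ ↔ ∃ ψ ∈ D, U ∈ ψ := by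
  constructor
  · intro hU
    let χ : OpenFilter X := ofProp (fun V => ∃ ψ ∈ D, V ∈ ψ)
      (by obtain ⟨ψ, hψ⟩ := hne; exact ⟨ψ, hψ, ψ.top_mem⟩)
      (by
        rintro V W ⟨ψ, hψ, hV⟩ ⟨ψ', hψ', hW⟩
        obtain ⟨ρ, hρ, h, h'⟩ := hD ψ hψ ψ' hψ'
        exact ⟨ρ, hρ, ρ.inf_mem (h hV) (h' hW)⟩)
      (by
        rintro V W h ⟨ψ, hψ, hV⟩
        exact ⟨ψ, hψ, ψ.mem_of_le h hV⟩)
    have hχ : χ ∈ upperBounds D := fun ψ hψ => le_def.2 fun V hV => ⟨ψ, hψ, hV⟩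
    exact le_def.1 (hφ.2 hχ) U hU
  · rintro ⟨ψ, hψ, hU⟩
    exact hφ.1 hψ hU

/-- The set `A^#` of all filters that contain the open set `A`. -/
def sharp (A : Opens X) : Set (OpenFilter X) := {φ | A ∈ φ}

/-- The topology generated by the sets `A^#`. -/
instance : TopologicalSpace (OpenFilter X) := generateFrom (Set.range sharp)

/-- `A^#` as an open set. -/
def sharpOpens (A : Opens X) : Opens (OpenFilter X) :=
  ⟨sharp A, isOpen_generateFrom_of_mem ⟨A, rfl⟩⟩

@[simp] theorem mem_sharpOpens {A : Opens X} {φ : OpenFilter X} : φ ∈ sharpOpens A ↔ A ∈ φ :=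
  Iff.rfl

theorem sharpOpens_inf (A B : Opens X) : sharpOpens (A ⊓ B) = sharpOpens A ⊓ sharpOpens B := by
  ext φ
  exact ⟨fun h => ⟨φ.mem_of_le inf_le_left h, φ.mem_of_le inf_le_right h⟩,
    fun h => φ.inf_mem h.1 h.2⟩

theorem sharpOpens_mono {A B : Opens X} (h : A ≤ B) : sharpOpens A ≤ sharpOpens B :=
  fun φ hφ => φ.mem_of_le h hφ

theorem sharpOpens_top : sharpOpens (⊤ : Opens X) = ⊤ := by
  ext φ
  exact ⟨fun _ => trivial, fun _ => φ.top_mem⟩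

instance : T0Space (OpenFilter X) := by
  refine ⟨fun φ ψ h => ext fun U => ?_⟩
  exact h.mem_open_iff (sharpOpens U).isOpen

/-- The image filter `{B | f⁻¹ B ∈ φ}`. -/
def map (f : C(X, Y)) : C(OpenFilter X, OpenFilter Y) where
  toFun φ := ofProp (fun B => Opens.comap f B ∈ φ) φ.top_mem (fun _ _ h h' => φ.inf_mem h h')
    (fun _ _ h h' => φ.mem_of_le (Opens.comap_mono f h) h')
  continuous_toFun := continuous_generateFrom_iff.2 <| by
    rintro _ ⟨B, rfl⟩
    exact (sharpOpens (Opens.comap f B)).isOpen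

@[simp] theorem mem_map {f : C(X, Y)} {φ : OpenFilter X} {B : Opens Y} :
    B ∈ map f φ ↔ Opens.comap f B ∈ φ := Iff.rfl

/-- The unit: a point goes to the filter of its open neighbourhoods. -/
def nbhd (X : Type u) [TopologicalSpace X] : C(X, OpenFilter X) where
  toFun x := ofProp (fun U => x ∈ U) trivial (fun _ _ h h' => ⟨h, h'⟩) (fun _ _ h h' => h h')
  continuous_toFun := continuous_generateFrom_iff.2 <| by
    rintro _ ⟨B, rfl⟩
    exact B.isOpen

@[simp] theorem mem_nbhd {x : X} {U : Opens X} : U ∈ nbhd X x ↔ x ∈ U := Iff.rfl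

/-- The multiplication: `Φ` goes to `{A | A^# ∈ Φ}`. -/
def join (X : Type u) [TopologicalSpace X] : C(OpenFilter (OpenFilter X), OpenFilter X) where
  toFun Φ := ofProp (fun A => sharpOpens A ∈ Φ)
    (by rw [sharpOpens_top]; exact Φ.top_mem)
    (fun A B h h' => by
      rw [sharpOpens_inf]; exact Φ.inf_mem h h')
    (fun _ _ h h' => Φ.mem_of_le (sharpOpens_mono h) h')
  continuous_toFun := continuous_generateFrom_iff.2 <| by
    rintro _ ⟨B, rfl⟩
    exact (sharpOpens (sharpOpens B)).isOpen

@[simp] theorem mem_join {Φ : OpenFilter (OpenFilter X)} {A : Opens X} :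
    A ∈ join X Φ ↔ sharpOpens A ∈ Φ := Iff.rfl

end OpenFilter

/-! ## The open filter monad on T₀ spaces -/

/-- The category of T₀ topological spaces and continuous maps. -/
abbrev Top0 : Type (u + 1) :=
  ObjectProperty.FullSubcategory (fun X : TopCat.{u} => T0Space X)

/-- The functor `X ↦ FX`. -/
def openFilterFunctor : Top0.{u} ⥤ Top0.{u} where
  obj X := ⟨TopCat.of (OpenFilter X.obj), inferInstanceAs (T0Space (OpenFilter X.obj))⟩
  map f := ObjectProperty.homMk (TopCat.ofHom (OpenFilter.map f.hom.hom))

/-- The open filter monad on the category of T₀ spaces. -/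
def openFilterMonad : Monad Top0.{u} where
  toFunctor := openFilterFunctor
  η := { app := fun X => ObjectProperty.homMk (TopCat.ofHom (OpenFilter.nbhd X.obj)) }
  μ := { app := fun X => ObjectProperty.homMk (TopCat.ofHom (OpenFilter.join X.obj)) }

/-! ## Continuous lattices -/

/-- The way-below relation. -/
def WayBelow {α : Type u} [CompleteLattice α] (x y : α) : Prop :=
  ∀ D : Set α, D.Nonempty → DirectedOn (· ≤ ·) D → y ≤ sSup D → ∃ d ∈ D, x ≤ d

/-- A complete lattice is continuous when each element is the directed supremum of the elements
way below it. -/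
def IsContinuousLattice (α : Type u) [CompleteLattice α] : Prop :=
  ∀ x : α, {y | WayBelow y x}.Nonempty ∧ DirectedOn (· ≤ ·) {y | WayBelow y x} ∧
    IsLUB {y | WayBelow y x} x

/-- The objects of the category of continuous lattices. -/
structure ContLat : Type (u + 1) where
  carrier : Type u
  [lattice : CompleteLattice carrier]
  continuous : IsContinuousLattice carrier

namespace ContLat

instance : CoeSort ContLat.{u} (Type u) := ⟨ContLat.carrier⟩

instance (A : ContLat.{u}) : CompleteLattice A := A.lattice

/-- Morphisms of continuous lattices: maps preserving directed suprema and arbitrary infima. -/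
@[ext] structure Hom (A B : ContLat.{u}) : Type u where
  toFun : A → B
  scottContinuous : ScottContinuous toFun
  map_sInf : ∀ s : Set A, toFun (sInf s) = sInf (toFun '' s)

instance : Category ContLat.{u} where
  Hom := Hom
  id A := ⟨id, fun _ _ _ _ h => by simpa using h, fun s => by simp⟩
  comp f g := ⟨g.toFun ∘ f.toFun,
    fun d hne hd a ha => by
      have h := g.scottContinuous (hne.image f.toFun)
        (hd.mono_comp (fun _ _ hxy => f.scottContinuous.monotone hxy))
        (f.scottContinuous hne hd ha)
      rwa [Set.image_image] at h,
    fun s => by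
      simp only [Function.comp_apply, f.map_sInf, g.map_sInf, Set.image_image]⟩

end ContLat

/-! ## The Kleisli category inside the category of continuous lattices -/

namespace OpenFilter

variable {X Y : Type u} [TopologicalSpace X] [TopologicalSpace Y]

theorem wayBelow_principal {U : Opens X} {φ : OpenFilter X} (h : U ∈ φ) :
    WayBelow (principal U) φ := by
  intro D hne hD hle
  obtain ⟨ψ, hψ, hU⟩ := (mem_of_isLUB hne hD (isLUB_sSup D)).1 (hle h)
  exact ⟨ψ, hψ, principal_le.2 hU⟩

theorem isContinuousLattice (X : Type u) [TopologicalSpace X] :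
    IsContinuousLattice (OpenFilter X) := by
  intro φ
  refine ⟨⟨principal ⊤, wayBelow_principal φ.top_mem⟩, ?_, ?_, ?_⟩
  · intro ψ hψ ψ' hψ'
    refine ⟨ψ ⊔ ψ', ?_, le_sup_left, le_sup_right⟩
    intro D hne hD hle
    obtain ⟨d, hd, h⟩ := hψ D hne hD hle
    obtain ⟨d', hd', h'⟩ := hψ' D hne hD hle
    obtain ⟨e, he, hde, hde'⟩ := hD d hd d' hd'
    exact ⟨e, he, sup_le (h.trans hde) (h'.trans hde')⟩
  · intro ψ hψ
    obtain ⟨d, hd, h⟩ := hψ {φ} (Set.singleton_nonempty φ) (directedOn_singleton φ)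
      (by simp)
    rw [Set.mem_singleton_iff] at hd
    exact hd ▸ h
  · intro ψ hψ U hU
    exact principal_le.1 (hψ (wayBelow_principal hU))

/-- A map of filters that is given on membership by some assignment of opens preserves directed
suprema and arbitrary infima. -/
theorem preserves_of_mem_iff (g : OpenFilter X → OpenFilter Y) (h : Opens Y → Opens X)
    (hg : ∀ φ B, B ∈ g φ ↔ h B ∈ φ) :
    ScottContinuous g ∧ ∀ s : Set (OpenFilter X), g (sInf s) = sInf (g '' s) := by
  refine ⟨fun D hne hD φ hφ => ⟨?_, ?_⟩, fun s => ext fun B => ?_⟩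
  · rintro _ ⟨ψ, hψ, rfl⟩ B hB
    exact (hg φ B).2 (hφ.1 hψ ((hg ψ B).1 hB))
  · intro χ hχ B hB
    obtain ⟨ψ, hψ, hU⟩ := (mem_of_isLUB hne hD hφ).1 ((hg φ B).1 hB)
    exact hχ ⟨ψ, hψ, rfl⟩ ((hg ψ B).2 hU)
  · rw [hg, mem_sInf, mem_sInf]
    constructor
    · rintro H _ ⟨φ, hφ, rfl⟩
      exact (hg φ B).2 (H φ hφ)
    · intro H φ hφ
      exact (hg φ B).1 (H _ ⟨φ, hφ, rfl⟩)

end OpenFilter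

/-- The canonical embedding of the Kleisli category of the open filter monad into continuous
lattices: it sends `X` to the lattice `FX` of filters ordered by inclusion (the specialisation
order of the space `FX`), and a Kleisli morphism `r : X ⟶ FY` to its extension
`m_Y ∘ F r : FX ⟶ FY`. -/
def kleisliToContLat : Kleisli openFilterMonad.{u} ⥤ ContLat.{u} where
  obj X := ⟨OpenFilter X.of.obj, OpenFilter.isContinuousLattice X.of.obj⟩
  map {X Y} r :=
    { toFun := fun φ => ((Kleisli.Adjunction.fromKleisli openFilterMonad).map r).hom.hom φ
      scottContinuous := (OpenFilter.preserves_of_mem_iff _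
        (fun B => Opens.comap r.of.hom.hom (OpenFilter.sharpOpens B)) (fun _ _ => Iff.rfl)).1
      map_sInf := (OpenFilter.preserves_of_mem_iff _
        (fun B => Opens.comap r.of.hom.hom (OpenFilter.sharpOpens B)) (fun _ _ => Iff.rfl)).2 }
  map_id X := by
    apply ContLat.Hom.ext
    funext φ
    exact congrArg (fun h => h.hom.hom φ)
      ((Kleisli.Adjunction.fromKleisli openFilterMonad).map_id X)
  map_comp f g := by
    apply ContLat.Hom.ext
    funext φ
    exact congrArg (fun h => h.hom.hom φ)
      ((Kleisli.Adjunction.fromKleisli openFilterMonad).map_comp f g)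

/-! ## Compact elements and duals of frames -/

/-- The poset of compact elements, with the induced order. -/
abbrev CompactElements (α : Type u) [PartialOrder α] : Type u := {a : α // IsCompactElement a}

/-- A poset is the dual of a frame. -/
def IsDualOfFrame (P : Type u) [PartialOrder P] : Prop :=
  ∃ (L : Type u) (_ : Order.Frame L), Nonempty (P ≃o Lᵒᵈ)

/-- The continuous lattices that are algebraic and whose poset of compact elements is the dual of
a frame. -/
def IsAlgebraicWithCoframeOfCompacts : ObjectProperty ContLat.{u} :=
  fun A => IsCompactlyGenerated A ∧ IsDualOfFrame (CompactElements A)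

/-! The compact elements of `FX` are exactly the principal filters, and `principal` reverses order,
so `K(FX)` is the dual of the frame of opens of `X`. A morphism of continuous lattices has a lower
adjoint, which preserves compact elements; hence a morphism `FX ⟶ FY` is determined by a map from
opens of `Y` to opens of `X`, and this yields a Kleisli morphism. So `kleisliToContLat` is full and
faithful.

Lower adjoints also carry algebraicity and the coframe law to retracts
(`CompactsFormCoframe.of_retract`). Conversely, if `K(A)` is a coframe, take `X = K(A)` with the
upper sets as opens: `infOpen` turns finite intersections into joins, and this makes `A` a retract
of `FX` through `ofElement` and `toElement`.

Idempotents of continuous lattices split through their fixed points, so the subcategory is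
idempotent complete. A full and faithful functor into such a category for which every object is a
retract of a value induces an equivalence from the Karoubi envelope. -/

/-! ## Compact elements of complete lattices -/

section CompactElements

variable {α β : Type u} [CompleteLattice α] [CompleteLattice β]

theorem isCompactElement_bot : IsCompactElement (⊥ : α) := by
  rintro s u ⟨a, ha⟩ - - -
  exact ⟨a, ha, bot_le⟩

theorem IsCompactElement.sup {a b : α} (ha : IsCompactElement a) (hb : IsCompactElement b) :
    IsCompactElement (a ⊔ b) := by
  intro s u hne hd hu hle
  obtain ⟨x, hx, hax⟩ := ha s u hne hd hu (le_sup_left.trans hle)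
  obtain ⟨y, hy, hby⟩ := hb s u hne hd hu (le_sup_right.trans hle)
  obtain ⟨z, hz, hxz, hyz⟩ := hd x hx y hy
  exact ⟨z, hz, sup_le (hax.trans hxz) (hby.trans hyz)⟩

/-- The compact elements are closed under arbitrary infima, and finite joins distribute over
arbitrary meets of compact elements. -/
structure CompactsFormCoframe (α : Type u) [CompleteLattice α] : Prop where
  isCompactElement_sInf : ∀ s : Set α, (∀ a ∈ s, IsCompactElement a) → IsCompactElement (sInf s)
  sup_sInf : ∀ (c : α) (s : Set α), IsCompactElement c → (∀ a ∈ s, IsCompactElement a) →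
    c ⊔ sInf s = ⨅ a ∈ s, c ⊔ a

theorem CompactsFormCoframe.isDualOfFrame (h : CompactsFormCoframe α) :
    IsDualOfFrame (CompactElements α) := by
  have key (s : Set (CompactElements α)) : ∀ a ∈ Subtype.val '' s, IsCompactElement a := by
    rintro _ ⟨a, -, rfl⟩
    exact a.2
  let : InfSet (CompactElements α) := ⟨fun s => ⟨sInf (Subtype.val '' s), h.isCompactElement_sInf _ (key s)⟩⟩
  let : CompleteLattice (CompactElements α) := completeLatticeOfInf _ fun s =>
    ⟨fun a ha => Subtype.coe_le_coe.1 (sInf_le (Set.mem_image_of_mem _ ha)),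
      fun b hb => Subtype.coe_le_coe.1 <| le_sInf <| by
        rintro _ ⟨a, ha, rfl⟩
        exact hb ha⟩
  suffices H : ∀ (a : CompactElements α) (s : Set (CompactElements α)),
      ⨅ b ∈ s, a ⊔ b ≤ a ⊔ sInf s by
    let : Order.Coframe (CompactElements α) := Order.Coframe.ofMinimalAxioms ⟨H⟩
    exact ⟨(CompactElements α)ᵒᵈ, inferInstance, ⟨OrderIso.dualDual _⟩⟩
  intro a s
  -- Joins of compact elements come here from `completeLatticeOfInf`, not from `α`; `h1` and `h2`
  -- compare the two.
  have h1 : a.1 ⊔ sInf (Subtype.val '' s) ≤ (a ⊔ sInf s).1 :=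
    sup_le (Subtype.coe_le_coe.2 le_sup_left)
      (Subtype.coe_le_coe.2 (le_sup_right : sInf s ≤ a ⊔ sInf s))
  rw [h.sup_sInf _ _ a.2 (key s)] at h1
  refine Subtype.coe_le_coe.1 (le_trans ?_ h1)
  refine le_iInf₂ ?_
  rintro _ ⟨b, hb, rfl⟩
  have h2 : a ⊔ b ≤ ⟨a.1 ⊔ b.1, a.2.sup b.2⟩ :=
    sup_le (Subtype.coe_le_coe.1 le_sup_left) (Subtype.coe_le_coe.1 le_sup_right)
  have h3 : ⨅ b ∈ s, a ⊔ b ≤ a ⊔ b := iInf₂_le b hb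
  exact Subtype.coe_le_coe.2 (h3.trans h2)

theorem IsDualOfFrame.compactsFormCoframe [IsCompactlyGenerated α]
    (h : IsDualOfFrame (CompactElements α)) : CompactsFormCoframe α := by
  obtain ⟨L, _, ⟨e⟩⟩ := h
  let : SemilatticeSup (CompactElements α) := Subtype.semilatticeSup fun _ _ ha hb => ha.sup hb
  -- Infima transported from `L` agree with those of `α`: the infimum among compact elements
  -- dominates every compact element below `sInf s`, and these determine `sInf s`.
  have lift (s : Set α) (hs : ∀ a ∈ s, IsCompactElement a) :
      e.symm (sInf (e '' {k | k.1 ∈ s})) = sInf s := by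
    have glb : IsGLB {k : CompactElements α | k.1 ∈ s} (e.symm (sInf (e '' {k | k.1 ∈ s}))) := by
      rw [← e.isGLB_image']
      simpa using! isGLB_sInf (e '' {k | k.1 ∈ s})
    refine le_antisymm (le_sInf fun a ha => Subtype.coe_le_coe.2 (glb.1 (show ⟨a, hs a ha⟩ ∈ _ from ha))) ?_
    refine le_iff_compact_le_imp.2 fun c hc hcs => ?_
    exact Subtype.coe_le_coe.2 (glb.2 (show ⟨c, hc⟩ ∈ _ from
      fun k hk => Subtype.coe_le_coe.1 (hcs.trans (sInf_le hk))))
  refine ⟨fun s hs => lift s hs ▸ Subtype.property _, fun c s hc hs => ?_⟩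
  refine le_antisymm (le_iInf₂ fun a ha => sup_le_sup_left (sInf_le ha) c) ?_
  refine le_iff_compact_le_imp.2 fun k hk hks => ?_
  rw [← lift s hs]
  have h1 : e ⟨k, hk⟩ ≤ e (⟨c, hc⟩ ⊔ e.symm (sInf (e '' {k | k.1 ∈ s}))) := by
    rw [map_sup, e.apply_symm_apply, sup_sInf_eq]
    refine le_iInf₂ ?_
    rintro _ ⟨a, ha, rfl⟩
    rw [← map_sup, e.le_iff_le]
    exact Subtype.coe_le_coe.1 (hks.trans (iInf₂_le a.1 ha))
  exact Subtype.coe_le_coe.2 (e.le_iff_le.1 h1)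

theorem isDualOfFrame_compactElements_iff [IsCompactlyGenerated α] :
    IsDualOfFrame (CompactElements α) ↔ CompactsFormCoframe α :=
  ⟨fun h => h.compactsFormCoframe, fun h => h.isDualOfFrame⟩

/-! ## Left adjoints of maps that preserve infima -/

/-- The left adjoint of a map that preserves infima. -/
def lowerAdjoint (g : α → β) (b : β) : α := sInf {a | b ≤ g a}

theorem gc_lowerAdjoint {g : α → β} (hg : ∀ s, g (sInf s) = sInf (g '' s)) :
    GaloisConnection (lowerAdjoint g) g := by
  have mono : Monotone g := by
    intro a b hab
    have h := hg {a, b}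
    rw [Set.image_pair, sInf_pair, sInf_pair, inf_eq_left.2 hab] at h
    exact inf_eq_left.1 h.symm
  refine fun b a => ⟨fun h => ?_, fun h => sInf_le h⟩
  refine le_trans ?_ (mono h)
  rw [lowerAdjoint, hg]
  refine le_sInf ?_
  rintro _ ⟨a, ha, rfl⟩
  exact ha

/-- By adjunction, `f b ≤ u` means `b ≤ g u`, and `g u` is again a directed supremum. -/
theorem IsCompactElement.map_lowerAdjoint {f : β → α} {g : α → β} (gc : GaloisConnection f g)
    (hg : ScottContinuous g) {b : β} (hb : IsCompactElement b) : IsCompactElement (f b) := by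
  intro s u hne hd hu hle
  obtain ⟨_, ⟨x, hx, rfl⟩, hbx⟩ := hb (g '' s) (g u) (hne.image g)
    (hd.mono_comp fun _ _ h => gc.monotone_u h) (hg hne hd hu) (gc.le_iff_le.1 hle)
  exact ⟨x, hx, gc.le_iff_le.2 hbx⟩

/-! ### Transfer along retracts -/

section Retract

variable {s : α → β} {r : β → α} {s' : β → α} {r' : α → β}

/-- Adjoints compose in reverse order, and the lower adjoint of the identity is the identity. -/
theorem lowerAdjoint_retract (hs : GaloisConnection s' s) (hr : GaloisConnection r' r)
    (h : ∀ a, r (s a) = a) (a : α) : s' (r' a) = a :=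
  eq_of_forall_ge_iff fun x => by rw [hs.le_iff_le, hr.le_iff_le, h]

theorem IsCompactlyGenerated.of_retract [IsCompactlyGenerated β] (hs : GaloisConnection s' s)
    (hr : GaloisConnection r' r) (hsc : ScottContinuous s) (h : ∀ a, r (s a) = a) :
    IsCompactlyGenerated α := by
  refine ⟨fun a => ?_⟩
  obtain ⟨t, ht, hta⟩ := IsCompactlyGenerated.exists_sSup_eq (r' a)
  refine ⟨s' '' t, ?_, ?_⟩
  · rintro _ ⟨b, hb, rfl⟩
    exact (ht b hb).map_lowerAdjoint hs hsc
  · rw [sSup_image, ← hs.l_sSup, hta, lowerAdjoint_retract hs hr h]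

theorem CompactsFormCoframe.of_retract (hβ : CompactsFormCoframe β) (hs : GaloisConnection s' s)
    (hr : GaloisConnection r' r) (hsc : ScottContinuous s) (hrc : ScottContinuous r)
    (h : ∀ a, r (s a) = a) : CompactsFormCoframe α := by
  have hid := lowerAdjoint_retract hs hr h
  -- Lower adjoints need not preserve infima, but infima in `α` can be computed in `β` and brought
  -- back by `s'`.
  have key (t : Set α) : s' (sInf (r' '' t)) = sInf t := by
    refine le_antisymm (le_sInf fun a ha => ?_) ?_
    · exact (hs.monotone_l (sInf_le (Set.mem_image_of_mem r' ha))).trans (hid a).le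
    · rw [← hid (sInf t)]
      refine hs.monotone_l (le_sInf ?_)
      rintro _ ⟨a, ha, rfl⟩
      exact hr.monotone_l (sInf_le ha)
  have hcomp (t : Set α) (ht : ∀ a ∈ t, IsCompactElement a) :
      ∀ b ∈ r' '' t, IsCompactElement b := by
    rintro _ ⟨a, ha, rfl⟩
    exact (ht a ha).map_lowerAdjoint hr hrc
  refine ⟨fun t ht => ?_, fun c t hc ht => ?_⟩
  · rw [← key]
    exact (hβ.isCompactElement_sInf _ (hcomp t ht)).map_lowerAdjoint hs hsc
  · have h1 := hβ.sup_sInf _ _ (hc.map_lowerAdjoint hr hrc) (hcomp t ht)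
    rw [iInf_image] at h1
    rw [← sInf_image, ← key (_ '' t), ← Set.image_comp, sInf_image]
    simp only [Function.comp_apply, hr.l_sup]
    rw [← h1, hs.l_sup, hid, key]

end Retract

end CompactElements

/-! ## The lattice of filters of open sets -/

namespace OpenFilter

variable {X : Type u} [TopologicalSpace X]

theorem mem_principal {U V : Opens X} : V ∈ principal U ↔ U ≤ V := Iff.rfl

theorem isCompactElement_principal (U : Opens X) : IsCompactElement (principal U) := by
  intro D φ hne hD hφ hle
  obtain ⟨ψ, hψ, hU⟩ := (mem_of_isLUB hne hD hφ).1 (principal_le.1 hle)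
  exact ⟨ψ, hψ, principal_le.2 hU⟩

theorem principal_sup (U V : Opens X) : principal U ⊔ principal V = principal (U ⊓ V) := by
  refine le_antisymm (sup_le (principal_le.2 (mem_principal.2 inf_le_left)) (principal_le.2 (mem_principal.2 inf_le_right))) ?_
  exact principal_le.2 (inf_mem _ (principal_le.1 le_sup_left) (principal_le.1 le_sup_right))

theorem sInf_principal (S : Set (Opens X)) : sInf (principal '' S) = principal (sSup S) := by
  ext V
  simp [mem_sInf, mem_principal]

theorem isLUB_principal (φ : OpenFilter X) : IsLUB (principal '' {U | U ∈ φ}) φ := by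
  refine ⟨?_, fun ψ hψ U hU => principal_le.1 (hψ ⟨U, hU, rfl⟩)⟩
  rintro _ ⟨U, hU, rfl⟩
  exact principal_le.2 hU

/-- A filter is the directed supremum of the principal filters of its members, so a compact one
equals one of these. -/
theorem exists_eq_principal {φ : OpenFilter X} (h : IsCompactElement φ) :
    ∃ U, principal U = φ := by
  obtain ⟨_, ⟨U, hU, rfl⟩, hle⟩ := h (principal '' {U | U ∈ φ}) φ ⟨_, ⊤, φ.top_mem, rfl⟩
    (by
      rintro _ ⟨U, hU, rfl⟩ _ ⟨V, hV, rfl⟩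
      exact ⟨_, ⟨U ⊓ V, φ.inf_mem hU hV, rfl⟩, principal_le.2 (mem_principal.2 inf_le_left),
        principal_le.2 (mem_principal.2 inf_le_right)⟩)
    (isLUB_principal φ) le_rfl
  exact ⟨U, (principal_le.2 hU).antisymm hle⟩

instance : IsCompactlyGenerated (OpenFilter X) where
  exists_sSup_eq φ := by
    refine ⟨principal '' {U | U ∈ φ}, ?_, (isLUB_principal φ).sSup_eq⟩
    rintro _ ⟨U, -, rfl⟩
    exact isCompactElement_principal U

/-- Through `principal`, the coframe law becomes the frame law `inf_sSup_eq` for opens. -/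
theorem compactsFormCoframe (X : Type u) [TopologicalSpace X] :
    CompactsFormCoframe (OpenFilter X) := by
  have key (s : Set (OpenFilter X)) (hs : ∀ φ ∈ s, IsCompactElement φ) :
      ∃ S, principal '' S = s := by
    refine ⟨{U | principal U ∈ s}, Set.Subset.antisymm ?_ fun φ hφ => ?_⟩
    · rintro _ ⟨U, hU, rfl⟩
      exact hU
    · obtain ⟨U, rfl⟩ := exists_eq_principal (hs φ hφ)
      exact ⟨U, hφ, rfl⟩
  refine ⟨fun s hs => ?_, fun c s hc hs => ?_⟩
  · obtain ⟨S, rfl⟩ := key s hs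
    rw [sInf_principal]
    exact isCompactElement_principal _
  · obtain ⟨S, rfl⟩ := key s hs
    obtain ⟨U, rfl⟩ := exists_eq_principal hc
    have h : ⨅ φ ∈ principal '' S, principal U ⊔ φ
        = sInf (principal '' ((fun V => U ⊓ V) '' S)) := by
      rw [iInf_image, ← Set.image_comp, sInf_image]
      simp only [Function.comp_apply, principal_sup]
    rw [h, sInf_principal, sInf_principal, principal_sup, inf_sSup_eq, sSup_image]

/-! ## Algebraic lattices as retracts of lattices of filters -/

variable {α : Type u} [CompleteLattice α]

/-- The space of compact elements, whose open sets are the upper sets. -/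
abbrev CompactElementSpace (α : Type u) [CompleteLattice α] : Type u :=
  Topology.WithUpperSet (CompactElements α)

instance : T0Space (CompactElementSpace α) := by
  refine ⟨fun a b h => ?_⟩
  have h1 := Topology.IsUpperSet.specializes_iff_le.1 h.specializes
  have h2 := Topology.IsUpperSet.specializes_iff_le.1 h.specializes'
  exact le_antisymm (α := CompactElements α) h2 h1

/-- The infimum of an open set of compact elements. -/
def infOpen (U : Opens (CompactElementSpace α)) : α := ⨅ k : CompactElements α, ⨅ _ : k ∈ U, k.1

/-- The compact elements above a given one, as an open set. -/
def above (k : CompactElements α) : Opens (CompactElementSpace α) :=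
  ⟨Set.Ici (Topology.WithUpperSet.toUpperSet k),
    Topology.IsUpperSet.isOpen_iff_isUpperSet.2 (isUpperSet_Ici _)⟩

theorem infOpen_above (k : CompactElements α) : infOpen (above k) = k.1 :=
  le_antisymm (iInf₂_le k le_rfl) (le_iInf₂ fun _ hl => hl)

theorem infOpen_anti {U V : Opens (CompactElementSpace α)} (h : U ≤ V) : infOpen V ≤ infOpen U :=
  le_iInf₂ fun k hk => iInf₂_le k (h hk)

theorem infOpen_eq_sInf (U : Opens (CompactElementSpace α)) :
    infOpen U = sInf (Subtype.val '' {k : CompactElements α | k ∈ U}) := by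
  rw [sInf_image]
  rfl

theorem infOpen_top : infOpen (⊤ : Opens (CompactElementSpace α)) = ⊥ :=
  eq_bot_iff.2 (iInf₂_le (⟨⊥, isCompactElement_bot⟩ : CompactElements α) trivial)

theorem isCompactElement_infOpen (h : CompactsFormCoframe α) (U : Opens (CompactElementSpace α)) :
    IsCompactElement (infOpen U) := by
  rw [infOpen_eq_sInf]
  refine h.isCompactElement_sInf _ ?_
  rintro _ ⟨k, -, rfl⟩
  exact k.2

theorem mem_of_le_compact {U : Opens (CompactElementSpace α)} {k l : CompactElements α} (h : k ≤ l)
    (hk : k ∈ U) : l ∈ U :=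
  Topology.IsUpperSet.isOpen_iff_isUpperSet.1 U.isOpen h hk

/-- Distributing twice reduces the right-hand side to the joins of an element of `U` and one of `V`,
which lie in both upper sets. This makes `ofElement` a filter. -/
theorem infOpen_inf_le (h : CompactsFormCoframe α) (U V : Opens (CompactElementSpace α)) :
    infOpen (U ⊓ V) ≤ infOpen U ⊔ infOpen V := by
  rw [infOpen_eq_sInf V, h.sup_sInf _ _ (isCompactElement_infOpen h U)
    (by rintro _ ⟨k, -, rfl⟩; exact k.2)]
  refine le_iInf₂ ?_
  rintro _ ⟨l, hl, rfl⟩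
  rw [sup_comm, infOpen_eq_sInf U, h.sup_sInf _ _ l.2 (by rintro _ ⟨k, -, rfl⟩; exact k.2)]
  refine le_iInf₂ ?_
  rintro _ ⟨k, hk, rfl⟩
  exact iInf₂_le (⟨l.1 ⊔ k.1, l.2.sup k.2⟩ : CompactElements α)
    ⟨mem_of_le_compact (Subtype.coe_le_coe.1 le_sup_right) hk,
      mem_of_le_compact (Subtype.coe_le_coe.1 le_sup_left) hl⟩

/-- The open sets of compact elements whose infimum lies below `a`. -/
def ofElement (h : CompactsFormCoframe α) (a : α) : OpenFilter (CompactElementSpace α) :=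
  ofProp (fun U => infOpen U ≤ a) (infOpen_top.trans_le bot_le)
    (fun U V hU hV => (infOpen_inf_le h U V).trans (sup_le hU hV))
    (fun _ _ hUV hU => (infOpen_anti hUV).trans hU)

theorem mem_ofElement {h : CompactsFormCoframe α} {a : α} {U : Opens (CompactElementSpace α)} :
    U ∈ ofElement h a ↔ infOpen U ≤ a := Iff.rfl

/-- The supremum of the compact elements that a filter generates. -/
def toElement (φ : OpenFilter (CompactElementSpace α)) : α :=
  sSup (Subtype.val '' {k : CompactElements α | above k ∈ φ})

/-- The intersection of `above l` and `above m` lies in `above (l ⊔ m)`, so the supremum defining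
`toElement` is directed and compactness of `k` applies. -/
theorem le_toElement {φ : OpenFilter (CompactElementSpace α)} {k : CompactElements α} :
    k.1 ≤ toElement φ ↔ above k ∈ φ := by
  refine ⟨fun hk => ?_, fun hk => le_sSup ⟨k, hk, rfl⟩⟩
  have hne : (Subtype.val '' {k : CompactElements α | above k ∈ φ}).Nonempty :=
    ⟨_, ⟨⊥, isCompactElement_bot⟩, φ.mem_of_le (fun l _ =>
      (bot_le : ⊥ ≤ (Topology.WithUpperSet.ofUpperSet l).1)) φ.top_mem, rfl⟩
  have hdir : DirectedOn (· ≤ ·) (Subtype.val '' {k : CompactElements α | above k ∈ φ}) := by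
    rintro _ ⟨l, hl, rfl⟩ _ ⟨m, hm, rfl⟩
    refine ⟨l.1 ⊔ m.1, ⟨⟨l.1 ⊔ m.1, l.2.sup m.2⟩, ?_, rfl⟩, le_sup_left, le_sup_right⟩
    refine φ.mem_of_le ?_ (φ.inf_mem hl hm)
    rintro x ⟨hlx, hmx⟩
    exact sup_le (a := l.1) (b := m.1) (c := (Topology.WithUpperSet.ofUpperSet x).1) hlx hmx
  obtain ⟨_, ⟨l, hl, rfl⟩, hkl⟩ := k.2 _ _ hne hdir (isLUB_sSup _) hk
  exact φ.mem_of_le (fun x hx => le_trans (α := CompactElements α) hkl hx) hl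

theorem toElement_ofElement [IsCompactlyGenerated α] (h : CompactsFormCoframe α) (a : α) :
    toElement (ofElement h a) = a := by
  have key (c : α) (hc : IsCompactElement c) : c ≤ toElement (ofElement h a) ↔ c ≤ a := by
    rw [le_toElement (k := ⟨c, hc⟩), mem_ofElement, infOpen_above]
  exact le_antisymm (le_iff_compact_le_imp.2 fun c hc => (key c hc).1)
    (le_iff_compact_le_imp.2 fun c hc => (key c hc).2)

theorem ofElement_sInf (h : CompactsFormCoframe α) (s : Set α) :
    ofElement h (sInf s) = sInf (ofElement h '' s) := by
  ext U
  simp [mem_ofElement, mem_sInf]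

/-- Closure of the compact elements under infima matters here: `infOpen U` is compact, so it lies
below a directed supremum only if it lies below a member. -/
theorem scottContinuous_ofElement (h : CompactsFormCoframe α) :
    ScottContinuous (ofElement h) := by
  intro D hne hD a ha
  refine ⟨?_, fun ψ hψ U hU => ?_⟩
  · rintro _ ⟨d, hd, rfl⟩ U hU
    exact le_trans hU (ha.1 hd)
  · obtain ⟨d, hd, hUd⟩ := isCompactElement_infOpen h U D a hne hD ha hU
    exact hψ ⟨d, hd, rfl⟩ hUd

theorem toElement_sInf [IsCompactlyGenerated α] (S : Set (OpenFilter (CompactElementSpace α))) :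
    toElement (sInf S) = sInf (toElement '' S) := by
  have key (c : α) (hc : IsCompactElement c) :
      c ≤ toElement (sInf S) ↔ c ≤ sInf (toElement '' S) := by
    rw [le_toElement (k := ⟨c, hc⟩), mem_sInf, le_sInf_iff, Set.forall_mem_image]
    exact forall₂_congr fun φ _ => (le_toElement (k := ⟨c, hc⟩)).symm
  exact le_antisymm (le_iff_compact_le_imp.2 fun c hc => (key c hc).1)
    (le_iff_compact_le_imp.2 fun c hc => (key c hc).2)

theorem scottContinuous_toElement [IsCompactlyGenerated α] :
    ScottContinuous (toElement (α := α)) := by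
  intro D hne hD φ hφ
  refine ⟨?_, fun b hb => le_iff_compact_le_imp.2 fun c hc hcφ => ?_⟩
  · rintro _ ⟨ψ, hψ, rfl⟩
    exact sSup_le_sSup (Set.image_mono fun k hk => hφ.1 hψ hk)
  · rw [le_toElement (k := ⟨c, hc⟩), mem_of_isLUB hne hD hφ] at hcφ
    obtain ⟨ψ, hψ, hcψ⟩ := hcφ
    exact ((le_toElement (k := ⟨c, hc⟩)).2 hcψ).trans (hb ⟨ψ, hψ, rfl⟩)

end OpenFilter

/-! ## Idempotents of continuous lattices -/

section WayBelow

variable {α : Type u} [CompleteLattice α]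

theorem WayBelow.le {x y : α} (h : WayBelow x y) : x ≤ y := by
  obtain ⟨d, hd, h⟩ := h {y} (Set.singleton_nonempty y) (directedOn_singleton y) (by simp)
  exact h.trans (Set.mem_singleton_iff.1 hd).le

theorem WayBelow.sup {x y z : α} (hx : WayBelow x z) (hy : WayBelow y z) : WayBelow (x ⊔ y) z := by
  intro D hne hD hle
  obtain ⟨d, hd, h⟩ := hx D hne hD hle
  obtain ⟨d', hd', h'⟩ := hy D hne hD hle
  obtain ⟨e, he, hde, hde'⟩ := hD d hd d' hd'
  exact ⟨e, he, sup_le (h.trans hde) (h'.trans hde')⟩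

theorem wayBelow_bot (x : α) : WayBelow ⊥ x := by
  rintro D ⟨d, hd⟩ - -
  exact ⟨d, hd, bot_le⟩

theorem isContinuousLattice_of_isLUB (h : ∀ x : α, IsLUB {y | WayBelow y x} x) :
    IsContinuousLattice α := fun x =>
  ⟨⟨⊥, wayBelow_bot x⟩,
    fun y hy z hz => ⟨y ⊔ z, WayBelow.sup hy hz, le_sup_left, le_sup_right⟩, h x⟩

end WayBelow

namespace ContLat

/-! ### Splitting an idempotent through its fixed points -/

section Fixed

variable {α : Type u} [CompleteLattice α] {p : α → α}

/-- The fixed points of a map that preserves infima form a complete lattice. -/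
@[reducible] def fixedLattice (hp : ∀ s, p (sInf s) = sInf (p '' s)) :
    CompleteLattice {a // p a = a} :=
  letI : InfSet {a // p a = a} := ⟨fun s => ⟨sInf (Subtype.val '' s), by
    rw [hp]
    congr 1
    ext a
    constructor
    · rintro ⟨_, ⟨b, hb, rfl⟩, rfl⟩
      exact ⟨b, hb, b.2.symm⟩
    · rintro ⟨b, hb, rfl⟩
      exact ⟨b.1, ⟨b, hb, rfl⟩, b.2⟩⟩⟩
  completeLatticeOfInf _ fun s =>
    ⟨fun a ha => Subtype.coe_le_coe.1 (sInf_le (Set.mem_image_of_mem _ ha)),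
      fun b hb => Subtype.coe_le_coe.1 <| le_sInf <| by
        rintro _ ⟨a, ha, rfl⟩
        exact hb ha⟩

/-- `p` preserves the directed supremum taken in `α` and fixes each member of `D`, so that supremum
is itself fixed. -/
theorem isLUB_val_of_directed (hs : ScottContinuous p) {D : Set {a // p a = a}}
    (hne : D.Nonempty) (hD : DirectedOn (· ≤ ·) D) {x : {a // p a = a}} (hx : IsLUB D x) :
    IsLUB (Subtype.val '' D) x.1 := by
  have h := hs (hne.image Subtype.val) (hD.mono_comp fun _ _ h => h)
    (isLUB_sSup (Subtype.val '' D))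
  have himg : p '' (Subtype.val '' D) = Subtype.val '' D := by
    rw [← Set.image_comp]
    exact Set.image_congr fun a _ => a.2
  rw [himg] at h
  have hfix : p (sSup (Subtype.val '' D)) = sSup (Subtype.val '' D) :=
    h.unique (isLUB_sSup _)
  refine ⟨?_, fun b hb => ?_⟩
  · rintro _ ⟨d, hd, rfl⟩
    exact hx.1 hd
  · have : x ≤ ⟨sSup (Subtype.val '' D), hfix⟩ :=
      hx.2 fun d hd => Subtype.coe_le_coe.1 (le_sSup (Set.mem_image_of_mem _ hd))
    exact le_trans (Subtype.coe_le_coe.2 this) (sSup_le hb)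

theorem isContinuousLattice_fixed (hp : ∀ s, p (sInf s) = sInf (p '' s))
    (hs : ScottContinuous p) (hpp : ∀ a, p (p a) = p a) (hα : IsContinuousLattice α) :
    @IsContinuousLattice {a // p a = a} (fixedLattice hp) := by
  let := fixedLattice hp
  refine isContinuousLattice_of_isLUB fun x => ⟨fun y hy => hy.le, fun b hb => ?_⟩
  obtain ⟨hne, hdir, hlub⟩ := hα x.1
  have h := hs hne hdir hlub
  rw [x.2] at h
  refine Subtype.coe_le_coe.1 (h.2 ?_)
  rintro _ ⟨z, hz, rfl⟩
  -- If `z` is way below `x` in `α`, then `p z` is way below `x` among the fixed points, and these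
  -- `p z` have supremum `p x = x`.
  refine Subtype.coe_le_coe.2 (hb (show ⟨p z, hpp z⟩ ∈ _ from ?_))
  intro D hD0 hD hle
  obtain ⟨_, ⟨d, hd, rfl⟩, hzd⟩ := hz (Subtype.val '' D) (hD0.image _)
    (hD.mono_comp fun _ _ h => h)
    ((Subtype.coe_le_coe.2 hle).trans
      (isLUB_val_of_directed hs hD0 hD (isLUB_sSup D)).sSup_eq.ge)
  refine ⟨d, hd, Subtype.coe_le_coe.1 ?_⟩
  exact (hs.monotone hzd).trans d.2.le

end Fixed

/-- The fixed points of an idempotent, as a continuous lattice. -/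
def fixed {A : ContLat.{u}} (p : A ⟶ A) (hp : p ≫ p = p) : ContLat.{u} :=
  letI := fixedLattice (Hom.map_sInf p)
  { carrier := {a : A // Hom.toFun p a = a}
    continuous := isContinuousLattice_fixed (Hom.map_sInf p) (Hom.scottContinuous p)
      (fun a => congrArg (fun f => Hom.toFun f a) hp) A.continuous }

/-- The inclusion of the fixed points of an idempotent. -/
def fixedIncl {A : ContLat.{u}} (p : A ⟶ A) (hp : p ≫ p = p) : fixed p hp ⟶ A where
  toFun := Subtype.val
  scottContinuous _ hne hD _ hx := isLUB_val_of_directed (Hom.scottContinuous p) hne hD hx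
  map_sInf _ := rfl

/-- The projection onto the fixed points of an idempotent. -/
def fixedProj {A : ContLat.{u}} (p : A ⟶ A) (hp : p ≫ p = p) : A ⟶ fixed p hp where
  toFun a := ⟨Hom.toFun p a, congrArg (fun f => Hom.toFun f a) hp⟩
  scottContinuous D hne hD a ha := by
    have h := Hom.scottContinuous p hne hD ha
    refine ⟨?_, fun b hb => h.2 ?_⟩
    · rintro _ ⟨d, hd, rfl⟩
      exact h.1 ⟨d, hd, rfl⟩
    · rintro _ ⟨d, hd, rfl⟩
      exact hb ⟨d, hd, rfl⟩
  map_sInf s := by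
    refine Subtype.ext ((Hom.map_sInf p s).trans (congrArg sInf (Set.ext fun b => ⟨?_, ?_⟩)))
    · rintro ⟨a, ha, rfl⟩
      exact ⟨_, ⟨a, ha, rfl⟩, rfl⟩
    · rintro ⟨_, ⟨a, ha, rfl⟩, rfl⟩
      exact ⟨a, ha, rfl⟩

theorem fixedIncl_proj {A : ContLat.{u}} (p : A ⟶ A) (hp : p ≫ p = p) :
    fixedIncl p hp ≫ fixedProj p hp = 𝟙 _ :=
  Hom.ext (funext fun a => Subtype.ext a.2)

theorem fixedProj_incl {A : ContLat.{u}} (p : A ⟶ A) (hp : p ≫ p = p) :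
    fixedProj p hp ≫ fixedIncl p hp = p := rfl

end ContLat

/-! ## The retracts of lattices of filters -/

theorem isAlgebraicWithCoframeOfCompacts_iff {A : ContLat.{u}} :
    IsAlgebraicWithCoframeOfCompacts A ↔ IsCompactlyGenerated A ∧ CompactsFormCoframe A :=
  and_congr_right fun _ => isDualOfFrame_compactElements_iff

theorem IsAlgebraicWithCoframeOfCompacts.of_retract {A B : ContLat.{u}} (h : Retract A B)
    (hB : IsAlgebraicWithCoframeOfCompacts B) : IsAlgebraicWithCoframeOfCompacts A := by
  rw [isAlgebraicWithCoframeOfCompacts_iff] at hB ⊢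
  obtain ⟨_, hB⟩ := hB
  have hid (a : A) : ContLat.Hom.toFun h.r (ContLat.Hom.toFun h.i a) = a :=
    congrArg (fun f => ContLat.Hom.toFun f a) h.retract
  have hi := gc_lowerAdjoint (ContLat.Hom.map_sInf h.i)
  have hr := gc_lowerAdjoint (ContLat.Hom.map_sInf h.r)
  exact ⟨.of_retract hi hr (ContLat.Hom.scottContinuous h.i) hid,
    hB.of_retract hi hr (ContLat.Hom.scottContinuous h.i) (ContLat.Hom.scottContinuous h.r) hid⟩

theorem isAlgebraicWithCoframeOfCompacts_kleisliToContLat (X : Kleisli openFilterMonad.{u}) :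
    IsAlgebraicWithCoframeOfCompacts (kleisliToContLat.obj X) :=
  isAlgebraicWithCoframeOfCompacts_iff.2
    ⟨inferInstanceAs (IsCompactlyGenerated (OpenFilter X.of.obj)),
      OpenFilter.compactsFormCoframe X.of.obj⟩

theorem IsAlgebraicWithCoframeOfCompacts.exists_retract {A : ContLat.{u}}
    (hA : IsAlgebraicWithCoframeOfCompacts A) :
    ∃ X : Kleisli openFilterMonad.{u}, Nonempty (Retract A (kleisliToContLat.obj X)) := by
  obtain ⟨_, h⟩ := isAlgebraicWithCoframeOfCompacts_iff.1 hA
  refine ⟨.mk _ ⟨TopCat.of (OpenFilter.CompactElementSpace A),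
    inferInstanceAs (T0Space (OpenFilter.CompactElementSpace A))⟩, ⟨?_⟩⟩
  exact
    { i := ⟨OpenFilter.ofElement h, OpenFilter.scottContinuous_ofElement h,
        OpenFilter.ofElement_sInf h⟩
      r := ⟨OpenFilter.toElement, OpenFilter.scottContinuous_toElement,
        OpenFilter.toElement_sInf⟩
      retract := ContLat.Hom.ext (funext (OpenFilter.toElement_ofElement h)) }

theorem isAlgebraicWithCoframeOfCompacts_iff_exists_retract (A : ContLat.{u}) :
    IsAlgebraicWithCoframeOfCompacts A ↔
      ∃ X : Kleisli openFilterMonad.{u}, Nonempty (Retract A (kleisliToContLat.obj X)) :=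
  ⟨fun h => h.exists_retract, fun ⟨X, ⟨h⟩⟩ =>
    .of_retract h (isAlgebraicWithCoframeOfCompacts_kleisliToContLat X)⟩

/-! ## The Kleisli category is a full subcategory -/

theorem mem_kleisliToContLat_map {X Y : Kleisli openFilterMonad.{u}} (r : X ⟶ Y)
    (φ : OpenFilter X.of.obj) (B : Opens Y.of.obj) :
    B ∈ (show OpenFilter Y.of.obj from ContLat.Hom.toFun (kleisliToContLat.map r) φ) ↔
      Opens.comap r.of.hom.hom (OpenFilter.sharpOpens B) ∈ φ := Iff.rfl

/-- Evaluating the extension of `r` at the neighbourhood filter of `x` gives back `r x`. -/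
instance : kleisliToContLat.{u}.Faithful where
  map_injective {X Y r s} h := by
    apply Kleisli.hom_ext
    ext x
    refine OpenFilter.ext fun B => ?_
    have h1 := congrArg (fun f => (show OpenFilter Y.of.obj from
      ContLat.Hom.toFun f (OpenFilter.nbhd X.of.obj x))) h
    have h2 := SetLike.ext_iff.1 h1 B
    exact h2

instance : kleisliToContLat.{u}.Full where
  map_surjective {X Y} g := by
    let g' : OpenFilter X.of.obj → OpenFilter Y.of.obj := ContLat.Hom.toFun g
    have gc : GaloisConnection (lowerAdjoint g') g' := gc_lowerAdjoint (ContLat.Hom.map_sInf g)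
    -- The lower adjoint preserves compactness, so it sends principal filters to principal filters;
    -- `h` is the resulting map of opens.
    have hU (B : Opens Y.of.obj) : ∃ U : Opens X.of.obj,
        OpenFilter.principal U = lowerAdjoint g' (OpenFilter.principal B) :=
      OpenFilter.exists_eq_principal
        ((OpenFilter.isCompactElement_principal B).map_lowerAdjoint gc
          (ContLat.Hom.scottContinuous g))
    choose h hh using hU
    have key (φ : OpenFilter X.of.obj) (B : Opens Y.of.obj) : B ∈ g' φ ↔ h B ∈ φ := by
      rw [← OpenFilter.principal_le, ← gc.le_iff_le, ← hh, OpenFilter.principal_le]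
    have hpre (B : Opens Y.of.obj) :
        (fun x => g' (OpenFilter.nbhd X.of.obj x)) ⁻¹' OpenFilter.sharp B = h B := by
      ext x
      exact key _ B
    -- The Kleisli morphism is the restriction of `g` to neighbourhood filters; the preimage of
    -- `sharp B` is `h B`, hence open.
    let r : C(X.of.obj, OpenFilter Y.of.obj) :=
      ⟨fun x => g' (OpenFilter.nbhd X.of.obj x), continuous_generateFrom_iff.2 <| by
        rintro _ ⟨B, rfl⟩
        rw [hpre]
        exact (h B).isOpen⟩
    refine ⟨.mk (ObjectProperty.homMk (TopCat.ofHom r)), ?_⟩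
    refine ContLat.Hom.ext (funext fun φ => OpenFilter.ext fun B => ?_)
    have hcomap : Opens.comap r (OpenFilter.sharpOpens B) = h B := Opens.ext (hpre B)
    refine (mem_kleisliToContLat_map _ φ B).trans (Iff.trans ?_ (key φ B).symm)
    exact hcomap ▸ Iff.rfl

/-! ## The idempotent split completion -/

/-- The Kleisli category inside the algebraic lattices with a coframe of compact elements. -/
def kleisliToAlgebraic :
    Kleisli openFilterMonad.{u} ⥤ IsAlgebraicWithCoframeOfCompacts.{u}.FullSubcategory :=
  IsAlgebraicWithCoframeOfCompacts.lift kleisliToContLat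
    isAlgebraicWithCoframeOfCompacts_kleisliToContLat

instance : kleisliToAlgebraic.{u}.Full := by unfold kleisliToAlgebraic; infer_instance

instance : kleisliToAlgebraic.{u}.Faithful := by unfold kleisliToAlgebraic; infer_instance

theorem exists_retract_kleisliToAlgebraic
    (A : IsAlgebraicWithCoframeOfCompacts.{u}.FullSubcategory) :
    ∃ X, Nonempty (Retract A (kleisliToAlgebraic.{u}.obj X)) := by
  obtain ⟨X, ⟨h⟩⟩ := A.property.exists_retract
  exact ⟨X, ⟨{ i := ObjectProperty.homMk h.i
               r := ObjectProperty.homMk h.r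
               retract := ObjectProperty.hom_ext _ h.retract }⟩⟩

/-- The fixed points of an idempotent are a retract of its carrier, and the subcategory is closed
under retracts. -/
instance : IsIdempotentComplete IsAlgebraicWithCoframeOfCompacts.{u}.FullSubcategory where
  idempotents_split A p hp := by
    have hp' : p.hom ≫ p.hom = p.hom := congrArg (fun f => f.hom) hp
    have h : Retract (ContLat.fixed p.hom hp') A.obj :=
      ⟨ContLat.fixedIncl _ hp', ContLat.fixedProj _ hp', ContLat.fixedIncl_proj _ hp'⟩
    exact ⟨⟨ContLat.fixed p.hom hp', .of_retract h A.property⟩,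
      ObjectProperty.homMk (ContLat.fixedIncl _ hp'),
      ObjectProperty.homMk (ContLat.fixedProj _ hp'),
      ObjectProperty.hom_ext _ (ContLat.fixedIncl_proj _ hp'),
      ObjectProperty.hom_ext _ (ContLat.fixedProj_incl _ hp')⟩

/-! ### Extension of full and faithful functors to Karoubi envelopes -/

section Karoubi

open Idempotents

variable {C : Type*} [Category* C] {D : Type*} [Category* D] (F : C ⥤ D)

instance [F.Faithful] : ((functorExtension₂ C D).obj F).Faithful where
  map_injective h := by
    ext
    exact F.map_injective (congrArg Karoubi.Hom.f h)

instance [F.Full] [F.Faithful] : ((functorExtension₂ C D).obj F).Full where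
  map_surjective {P Q} g := by
    obtain ⟨f, hf⟩ := F.map_surjective g.f
    refine ⟨⟨f, F.map_injective ?_⟩, ?_⟩
    · have := g.comm
      simp only [F.map_comp, hf]
      exact this
    · ext
      exact hf

/-- Conjugating the idempotent of `P` by the retraction gives an idempotent on `F.obj X`; it lifts
to `q` by fullness, and `(X, q)` maps to an object isomorphic to `P`. -/
theorem essSurj_functorExtension₂ [F.Full] [F.Faithful]
    (h : ∀ A : D, ∃ X, Nonempty (Retract A (F.obj X))) :
    ((functorExtension₂ C D).obj F).EssSurj where
  mem_essImage P := by
    obtain ⟨X, ⟨ρ⟩⟩ := h P.X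
    obtain ⟨q, hq⟩ := F.map_surjective (ρ.r ≫ P.p ≫ ρ.i)
    have hqq : q ≫ q = q := F.map_injective <| by
      simp [hq]
    -- `h1` and `h2` say that the two maps are morphisms of the envelope; `h3` and `h4` say that
    -- they are inverse, since the identity of a Karoubi object is its idempotent.
    have h1 : F.map q ≫ (ρ.r ≫ P.p) ≫ P.p = ρ.r ≫ P.p := by simp [hq]
    have h2 : P.p ≫ (P.p ≫ ρ.i) ≫ F.map q = P.p ≫ ρ.i := by simp [hq]
    have h3 : (ρ.r ≫ P.p) ≫ P.p ≫ ρ.i = F.map q := by simp [hq]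
    have h4 : (P.p ≫ ρ.i) ≫ ρ.r ≫ P.p = P.p := by simp
    refine ⟨⟨X, q, hqq⟩, ⟨⟨⟨ρ.r ≫ P.p, ?_⟩, ⟨P.p ≫ ρ.i, ?_⟩, ?_, ?_⟩⟩⟩
    · exact h1
    · exact h2
    · ext
      exact h3
    · ext
      exact h4

end Karoubi

instance : (Idempotents.functorExtension₂ _ _ |>.obj kleisliToAlgebraic.{u}).IsEquivalence where
  essSurj := essSurj_functorExtension₂ _ exists_retract_kleisliToAlgebraic

/-- The Karoubi envelope of the Kleisli category. -/
noncomputable def karoubiKleisliEquivalence :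
    Idempotents.Karoubi (Kleisli openFilterMonad.{u}) ≌
      IsAlgebraicWithCoframeOfCompacts.{u}.FullSubcategory :=
  ((Idempotents.functorExtension₂ _ _).obj kleisliToAlgebraic).asEquivalence.trans
    (Idempotents.toKaroubiEquivalence _).symm

/-- The equivalence extends the canonical functor. -/
noncomputable def toKaroubiCompKaroubiKleisliEquivalence :
    Idempotents.toKaroubi (Kleisli openFilterMonad.{u}) ⋙ karoubiKleisliEquivalence.functor ≅
      kleisliToAlgebraic :=
  Functor.isoWhiskerRight ((Idempotents.functorExtension₂CompWhiskeringLeftToKaroubiIso _ _).app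
      kleisliToAlgebraic) (Idempotents.toKaroubiEquivalence _).inverse ≪≫
    Functor.isoWhiskerLeft kleisliToAlgebraic (Idempotents.toKaroubiEquivalence _).unitIso.symm ≪≫
    kleisliToAlgebraic.rightUnitor

theorem mainTheorem6 :
    -- the Karoubi envelope of the Kleisli category is the full subcategory, compatibly with the
    -- embeddings of the Kleisli category
    (∃ E : Idempotents.Karoubi (Kleisli openFilterMonad.{u}) ≌
        IsAlgebraicWithCoframeOfCompacts.{u}.FullSubcategory,
      Nonempty (Idempotents.toKaroubi (Kleisli openFilterMonad.{u}) ⋙ E.functor ⋙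
        IsAlgebraicWithCoframeOfCompacts.{u}.ι ≅ kleisliToContLat.{u})) ∧
    -- its objects are exactly the retracts of the lattices `FX` among continuous lattices
    (∀ A : ContLat.{u}, IsAlgebraicWithCoframeOfCompacts A ↔
      ∃ X : Kleisli openFilterMonad.{u}, Nonempty (Retract A (kleisliToContLat.obj X))) ∧
    -- the elementary description of the condition on the compact elements
    (∀ (α : Type u) [CompleteLattice α], IsCompactlyGenerated α →
      (IsDualOfFrame (CompactElements α) ↔
        (∀ s : Set α, (∀ a ∈ s, IsCompactElement a) → IsCompactElement (sInf s)) ∧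
        (∀ (c : α) (s : Set α), IsCompactElement c → (∀ a ∈ s, IsCompactElement a) →
          c ⊔ sInf s = ⨅ a ∈ s, c ⊔ a))) := by
  refine ⟨⟨karoubiKleisliEquivalence, ⟨?_⟩⟩,
    isAlgebraicWithCoframeOfCompacts_iff_exists_retract, fun α _ _ => ?_⟩
  · exact Functor.isoWhiskerRight toKaroubiCompKaroubiKleisliEquivalence
        IsAlgebraicWithCoframeOfCompacts.ι ≪≫
      IsAlgebraicWithCoframeOfCompacts.liftCompιIso kleisliToContLat
        isAlgebraicWithCoframeOfCompacts_kleisliToContLat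
  · rw [isDualOfFrame_compactElements_iff]
    exact ⟨fun h => ⟨h.isCompactElement_sInf, h.sup_sInf⟩, fun h => ⟨h.1, h.2⟩⟩
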